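/- Let $n,k\ge 0$, let $p_1,\dots,p_k\in\mathbb{R}^n$, and for $i\neq j$ let $H_{ij}=H_{ji}=\{x\in\mathbb{R}^n : |x-p_i|=|x-p_j|\}$. Call $p_1,\dots,p_k$ generic if, for every set $E$ of unordered pairs of distinct indices which, viewed as the edge set of a graph on $\{1,\dots,k\}$, contains no cycle: (1) if $|E|=n+1$, then $\bigcap_{\{i,j\}\in E}H_{ij}=\emptyset$; (2) if $|E|=m\le n$, then $\bigcap_{\{i,j\}\in E}H_{ij}$ is a nonempty affine subspace of dimension $n-m$. (In particular generic points are distinct, and $H_{ij}$ is the perpendicular bisector of $p_i$ and $p_j$.) If $n\ge 1$, then almost all $k$-tuples $(p_1,\dots,p_k)\in(\mathbb{R}^n)^k$, with respect to Lebesgue measure, are generic. Let $p_1,\dots,p_k\in\mathbb{R}^n$ be generic. Suppose that all the points emit a flash of light simultaneously. Then the number of different orders without ties in which the flashes can be observed from points $x\in\mathbb{R}^n$, i.e., the number of permutations $\sigma$ of $\{1,\dots,k\}$ such that $|x-p_{\sigma(1)}|<|x-p_{\sigma(2)}|<\cdots<|x-p_{\sigma(k)}|$ for some $x\in\mathbb{R}^n$,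 is equal to the number of regions into which the hyperplanes $H_{ij}$ ($1\le i<j\le k$) divide $\mathbb{R}^n$, i.e., the number of connected components of $\mathbb{R}^n\setminus\bigcup_{i<j}H_{ij}$, and this number is $$c(k,k)+c(k,k-1)+\cdots+c(k,k-n),$$ where $c(k,i)$ is the signless Stirling number of the first kind (the number of permutations of a $k$-element set with exactly $i$ cycles), and $c(k,i)=0$ for $i<0$. -/

import Mathlib

namespace GoodTideman

/-- The common intersection of the perpendicular bisectors of the pairs `p i`, `p j`, where `ij`
runs over the edges of the graph `G`. For the graph without edges it is the whole space. -/
noncomputable def bisectorFlat {n k : ℕ} (p : Fin k → EuclideanSpace ℝ (Fin n))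
    (G : SimpleGraph (Fin k)) : AffineSubspace ℝ (EuclideanSpace ℝ (Fin n)) :=
  ⨅ (i : Fin k) (j : Fin k) (_ : G.Adj i j), AffineSubspace.perpBisector (p i) (p j)

/-- Genericity of `k` points of `ℝⁿ`, in terms of their perpendicular bisectors `H i j`. A set of
bisectors is given by the graph of its index pairs. Along a cycle
`H i₁ i₂, H i₂ i₃, …, H iₘ i₁` each bisector contains the intersection of the others, for any
points whatsoever; the points are generic if these are the only dependencies:
no `n + 1` bisectors intersect, and any `m ≤ n` bisectors intersect in codimension `m`,
unless they contain a cycle. -/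
structure IsGeneric {n k : ℕ} (p : Fin k → EuclideanSpace ℝ (Fin n)) : Prop where
  /-- No `n + 1` of the bisectors, free of cycles, have a common point. -/
  not_intersect : ∀ G : SimpleGraph (Fin k), G.IsAcyclic → G.edgeSet.ncard = n + 1 →
    (bisectorFlat p G : Set (EuclideanSpace ℝ (Fin n))) = ∅
  /-- Any `m ≤ n` of the bisectors, free of cycles, intersect in an affine subspace of
  dimension `n - m`. -/
  codim : ∀ G : SimpleGraph (Fin k), G.IsAcyclic → G.edgeSet.ncard ≤ n →
    (bisectorFlat p G : Set (EuclideanSpace ℝ (Fin n))).Nonempty ∧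
      Module.finrank ℝ (bisectorFlat p G).direction + G.edgeSet.ncard = n

/-- The complement in `ℝⁿ` of the union of the perpendicular bisectors of the points `p i`. -/
def bisectorComplement {n k : ℕ} (p : Fin k → EuclideanSpace ℝ (Fin n)) :
    Set (EuclideanSpace ℝ (Fin n)) :=
  {x | ∀ i j : Fin k, i < j → x ∉ AffineSubspace.perpBisector (p i) (p j)}

/-- The regions of the arrangement of the perpendicular bisectors of the points `p i`: the
connected components of the complement of their union. -/
def regions {n k : ℕ} (p : Fin k → EuclideanSpace ℝ (Fin n)) :
    Set (Set (EuclideanSpace ℝ (Fin n))) :=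
  {R | ∃ x ∈ bisectorComplement p, R = connectedComponentIn (bisectorComplement p) x}

/-- The orders in which simultaneous flashes at the points `p i` can be observed: the order
`σ 0, σ 1, …, σ (k - 1)` is observed at `x` if the light of `p (σ 0)` reaches `x` strictly first,
then that of `p (σ 1)`, and so on. -/
def observableOrders {n k : ℕ} (p : Fin k → EuclideanSpace ℝ (Fin n)) :
    Set (Equiv.Perm (Fin k)) :=
  {σ | ∃ x : EuclideanSpace ℝ (Fin n), StrictMono fun a : Fin k => dist x (p (σ a))}

end GoodTideman

namespace GoodTideman

open Set Filter Topology MeasureTheory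


/-! Since |x - p j|² - |x - p i|² is affine in x, an observed order and a region off the bisectors
are both determined by, and determine, the signs of these forms. Both counts therefore equal
`orderCount` (`ncard_observableOrders`, `ncard_regions`).

The patterns are counted by adding points one at a time, on a flat X. By deletion and restriction
(`ncard_signPatterns_insert`), adding H_ja contributes the number of patterns on X ∩ H_ja. There a
and j are equidistant, so every other H_ia cuts like H_ij, which is already present. Hence N(S ∪
{a}, X) = N(S, X) + ∑ j ∈ S, N(S, X ∩ H_ja). If X is the flat of a forest, so is X ∩ H_ja, and
genericity makes the count depend only on |S| and the number of edges; the recursion is that of the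
Stirling sums.

Genericity follows from linear independence of edge differences along forests. This holds almost
everywhere by removing a leaf: moving the leaf alone, dependence confines it to a hyperplane or
sphere, and Fubini applies. -/

theorem ncard_image_eq_of_forall_iff {α β γ : Type*} {f : α → β} {g : α → γ} {s : Set α}
    (h : ∀ x ∈ s, ∀ y ∈ s, f x = f y ↔ g x = g y) : (f '' s).ncard = (g '' s).ncard := by
  choose c hc hfc using fun b (hb : b ∈ f '' s) => hb
  refine Set.ncard_congr (fun b hb => g (c b hb)) (fun b hb => ⟨_, hc b hb, rfl⟩) ?_ ?_
  · intro b b' hb hb' e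
    exact (hfc b hb).symm.trans (((h _ (hc b hb) _ (hc b' hb')).2 e).trans (hfc b' hb'))
  · rintro _ ⟨x, hx, rfl⟩
    have hb : f x ∈ f '' s := ⟨x, hx, rfl⟩
    exact ⟨_, hb, (h _ (hc _ hb) _ hx).1 (hfc _ hb)⟩

/-- The sign patterns of the functions `g a`, `a ∈ P`, at the points of `X` at which none of them
vanishes. A pattern is given by the set of `a ∈ P` with `g a` positive. -/
def signPatterns {α V : Type*} (g : α → V → ℝ) (P : Set α) (X : Set V) : Set (Set α) :=
  (fun x => {a ∈ P | 0 < g a x}) '' {x ∈ X | ∀ a ∈ P, g a x ≠ 0}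

theorem sep_pos_eq_iff {g : α → V → ℝ} {P : Set α} {x y : V} :
    {a ∈ P | 0 < g a x} = {a ∈ P | 0 < g a y} ↔ ∀ a ∈ P, 0 < g a x ↔ 0 < g a y := by
  simp only [Set.ext_iff, mem_ofPred_eq]
  exact forall_congr' fun a => by tauto

/-! ### Deletion and restriction for affine arrangements -/

section

variable {α V : Type*} [AddCommGroup V] [Module ℝ V]

/-- On the line through x and y the form `g a` has a simple zero at x, hence both signs nearby,
while the finitely many other forms keep their signs by continuity. -/
theorem exists_perturbation {g : α → V →ᵃ[ℝ] ℝ} {P : Set α} (hP : P.Finite)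
    {X : AffineSubspace ℝ V} {a : α} {x y : V} (hx : x ∈ X) (hy : y ∈ X) (hxa : g a x = 0)
    (hya : g a y ≠ 0) (hxP : ∀ b ∈ P, g b x ≠ 0) :
    (∃ z ∈ X, 0 < g a z ∧ ∀ b ∈ P, g b z ≠ 0 ∧ (0 < g b z ↔ 0 < g b x)) ∧
      ∃ z ∈ X, g a z < 0 ∧ ∀ b ∈ P, g b z ≠ 0 ∧ (0 < g b z ↔ 0 < g b x) := by
  have key : ∀ b t, g b (AffineMap.lineMap x y t) = g b x + t * (g b y - g b x) := by
    intro b t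
    rw [AffineMap.apply_lineMap, AffineMap.lineMap_apply]
    simp; ring
  have ev : ∀ᶠ t in 𝓝 (0 : ℝ), ∀ b ∈ P, g b (AffineMap.lineMap x y t) ≠ 0 ∧
      (0 < g b (AffineMap.lineMap x y t) ↔ 0 < g b x) := by
    rw [Filter.eventually_all_finite hP]
    intro b hb
    simp only [key]
    have hc : Tendsto (fun t : ℝ => g b x + t * (g b y - g b x)) (𝓝 0) (𝓝 (g b x)) := by
      have : Continuous fun t : ℝ => g b x + t * (g b y - g b x) := by fun_prop
      simpa using this.tendsto 0
    rcases (hxP b hb).lt_or_gt with h | h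
    · filter_upwards [hc.eventually_lt_const h] with t ht
      exact ⟨ht.ne, by simp [not_lt.2 ht.le, not_lt.2 h.le]⟩
    · filter_upwards [hc.eventually_const_lt h] with t ht
      exact ⟨ht.ne', by simp [ht, h]⟩
  obtain ⟨ε, hε, H⟩ := Metric.eventually_nhds_iff.1 ev
  have hm : ∀ t : ℝ, AffineMap.lineMap x y t ∈ X := fun t => AffineMap.lineMap_mem t hx hy
  have H1 := H (y := ε / 2) (by rw [Real.dist_eq, sub_zero, abs_of_pos] <;> linarith)
  have H2 := H (y := -(ε / 2)) (by rw [Real.dist_eq, sub_zero, abs_neg, abs_of_pos] <;> linarith)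
  have k1 := key a (ε / 2)
  have k2 := key a (-(ε / 2))
  rw [hxa] at k1 k2
  rcases hya.lt_or_gt with h | h
  · exact ⟨⟨_, hm _, by rw [k2]; nlinarith, H2⟩, ⟨_, hm _, by rw [k1]; nlinarith, H1⟩⟩
  · exact ⟨⟨_, hm _, by rw [k1]; nlinarith, H1⟩, ⟨_, hm _, by rw [k2]; nlinarith, H2⟩⟩

theorem exists_zero_of_neg_of_pos {g : α → V →ᵃ[ℝ] ℝ} {P : Set α}
    {X : AffineSubspace ℝ V} {a : α} {x y : V} (hx : x ∈ X) (hy : y ∈ X) (hxa : g a x < 0)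
    (hya : 0 < g a y) (hxP : ∀ b ∈ P, g b x ≠ 0) (hyP : ∀ b ∈ P, g b y ≠ 0)
    (h : ∀ b ∈ P, 0 < g b x ↔ 0 < g b y) :
    ∃ z ∈ X, g a z = 0 ∧ ∀ b ∈ P, g b z ≠ 0 ∧ (0 < g b z ↔ 0 < g b x) := by
  have key : ∀ b t, g b (AffineMap.lineMap x y t) = (1 - t) * g b x + t * g b y := by
    intro b t
    rw [AffineMap.apply_lineMap, AffineMap.lineMap_apply]
    simp; ring
  have hd : 0 < g a y - g a x := by linarith
  set t := -g a x / (g a y - g a x) with ht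
  have t0 : 0 < t := div_pos (by linarith) hd
  have t1 : 0 < 1 - t := by
    rw [ht, sub_pos, div_lt_one hd]; linarith
  refine ⟨AffineMap.lineMap x y t, AffineMap.lineMap_mem t hx hy, ?_, ?_⟩
  · rw [key, ht]; field_simp; ring
  · intro b hb
    rw [key]
    have hxy := h b hb
    rcases (hxP b hb).lt_or_gt with h1 | h1
    · have h2 : g b y < 0 := lt_of_le_of_ne
        (not_lt.1 fun hlt => absurd (hxy.2 hlt) (not_lt.2 h1.le)) (hyP b hb)
      have : (1 - t) * g b x + t * g b y < 0 := by nlinarith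
      exact ⟨this.ne, by simp [not_lt.2 this.le, not_lt.2 h1.le]⟩
    · have h2 := hxy.1 h1
      have : 0 < (1 - t) * g b x + t * g b y := by positivity
      exact ⟨this.ne', by simp [this, h1]⟩

/-- Deletion and restriction for the number of regions of an affine arrangement. -/
theorem ncard_signPatterns_insert [Finite α] (g : α → V →ᵃ[ℝ] ℝ) {P : Set α}
    (X : AffineSubspace ℝ V) {a : α} (ha : a ∉ P) (hX : ∃ y ∈ X, g a y ≠ 0) :
    (signPatterns (fun b => ⇑(g b)) (insert a P) (X : Set V)).ncard =
      (signPatterns (fun b => ⇑(g b)) P (X : Set V)).ncard +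
        (signPatterns (fun b => ⇑(g b)) P {x ∈ (X : Set V) | g a x = 0}).ncard := by
  obtain ⟨y, hy, hya⟩ := hX
  -- Patterns of P are sorted by the side of `a` on which they occur. Those on both sides are
  -- exactly those met on the zero set, so |B₁| + |B₂| = |B₁ ∪ B₂| + |B₁ ∩ B₂| gives the formula.
  set B₁ := signPatterns (fun b => ⇑(g b)) P {x ∈ (X : Set V) | 0 < g a x} with hB₁
  set B₂ := signPatterns (fun b => ⇑(g b)) P {x ∈ (X : Set V) | g a x < 0} with hB₂
  have hnot : ∀ B ∈ B₁ ∪ B₂, a ∉ B := by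
    rintro B (⟨x, hx, rfl⟩ | ⟨x, hx, rfl⟩) h <;> exact ha h.1
  have e1 : signPatterns (fun b => ⇑(g b)) (insert a P) (X : Set V) = (insert a '' B₁) ∪ B₂ := by
    ext s
    constructor
    · rintro ⟨x, ⟨hx, hxP⟩, rfl⟩
      rcases (hxP a (mem_insert _ _)).lt_or_gt with h | h
      · refine Or.inr ⟨x, ⟨⟨hx, h⟩, fun b hb => hxP b (mem_insert_of_mem _ hb)⟩, ?_⟩
        ext b
        by_cases hb : b = a
        · subst hb; simp [ha, h.le]
        · simp [hb]
      · refine Or.inl ⟨_, ⟨x, ⟨⟨hx, h⟩, fun b hb => hxP b (mem_insert_of_mem _ hb)⟩, rfl⟩, ?_⟩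
        ext b
        by_cases hb : b = a
        · subst hb; simp [h]
        · simp [hb]
    · rintro (⟨_, ⟨x, ⟨⟨hx, h⟩, hxP⟩, rfl⟩, rfl⟩ | ⟨x, ⟨⟨hx, h⟩, hxP⟩, rfl⟩)
      · refine ⟨x, ⟨hx, ?_⟩, ?_⟩
        · rintro b (rfl | hb)
          exacts [h.ne', hxP b hb]
        · ext b
          by_cases hb : b = a
          · subst hb; simp [h]
          · simp [hb]
      · refine ⟨x, ⟨hx, ?_⟩, ?_⟩
        · rintro b (rfl | hb)
          exacts [h.ne, hxP b hb]
        · ext b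
          by_cases hb : b = a
          · subst hb; simp [ha, h.le]
          · simp [hb]
  have hdisj : Disjoint (insert a '' B₁) B₂ := by
    rw [Set.disjoint_left]
    rintro _ ⟨s, -, rfl⟩ h
    exact hnot _ (Or.inr h) (mem_insert _ _)
  have hinj : Set.InjOn (insert a) B₁ := by
    intro s hs t ht e
    rw [← insert_sdiff_self_of_notMem (hnot s (Or.inl hs)), e,
      insert_sdiff_self_of_notMem (hnot t (Or.inl ht))]
  have hsign : ∀ x z : V, (∀ b ∈ P, g b z ≠ 0 ∧ (0 < g b z ↔ 0 < g b x)) →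
      {b ∈ P | 0 < g b z} = {b ∈ P | 0 < g b x} := fun x z h =>
    sep_pos_eq_iff (g := fun b => ⇑(g b)).2 fun b hb => (h b hb).2
  have e2 : signPatterns (fun b => ⇑(g b)) P (X : Set V) = B₁ ∪ B₂ := by
    apply Set.Subset.antisymm
    · rintro _ ⟨x, ⟨hx, hxP⟩, rfl⟩
      rcases lt_trichotomy (g a x) 0 with h | h | h
      · exact Or.inr ⟨x, ⟨⟨hx, h⟩, hxP⟩, rfl⟩
      · obtain ⟨z, hz, hza, hzP⟩ := (exists_perturbation P.toFinite hx hy h hya hxP).1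
        exact Or.inl ⟨z, ⟨⟨hz, hza⟩, fun b hb => (hzP b hb).1⟩, hsign _ _ hzP⟩
      · exact Or.inl ⟨x, ⟨⟨hx, h⟩, hxP⟩, rfl⟩
    · rintro _ (⟨x, ⟨⟨hx, -⟩, hxP⟩, rfl⟩ | ⟨x, ⟨⟨hx, -⟩, hxP⟩, rfl⟩) <;>
        exact ⟨x, ⟨hx, hxP⟩, rfl⟩
  have e3 : signPatterns (fun b => ⇑(g b)) P {x ∈ (X : Set V) | g a x = 0} = B₁ ∩ B₂ := by
    apply Set.Subset.antisymm
    · rintro _ ⟨x, ⟨⟨hx, hxa⟩, hxP⟩, rfl⟩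
      obtain ⟨⟨z, hz, hza, hzP⟩, ⟨w, hw, hwa, hwP⟩⟩ :=
        exists_perturbation P.toFinite hx hy hxa hya hxP
      exact ⟨⟨z, ⟨⟨hz, hza⟩, fun b hb => (hzP b hb).1⟩, hsign _ _ hzP⟩,
        ⟨w, ⟨⟨hw, hwa⟩, fun b hb => (hwP b hb).1⟩, hsign _ _ hwP⟩⟩
    · rintro _ ⟨⟨x, ⟨⟨hx, hxa⟩, hxP⟩, rfl⟩, ⟨w, ⟨⟨hw, hwa⟩, hwP⟩, h⟩⟩
      obtain ⟨z, hz, hza, hzP⟩ := exists_zero_of_neg_of_pos (g := g) hw hx hwa hxa hwP hxP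
        (sep_pos_eq_iff.1 h)
      exact ⟨z, ⟨⟨hz, hza⟩, fun b hb => (hzP b hb).1⟩, (hsign _ _ hzP).trans h⟩
  rw [e1, Set.ncard_union_eq hdisj (Set.toFinite _) (Set.toFinite _), hinj.ncard_image, e2, e3,
    Set.ncard_union_add_ncard_inter]

end


/-! ### Stirling sums and the recursion for orders -/

/-- The sum `c(k,k) + c(k,k-1) + ⋯ + c(k,k-(d-1))` of `d` signless Stirling numbers. -/
def stirlingSum (k d : ℕ) : ℕ :=
  ∑ i ∈ Finset.range d, if i ≤ k then Nat.stirlingFirst k (k - i) else 0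

theorem stirlingSum_zero_succ (d : ℕ) : stirlingSum 0 (d + 1) = 1 := by
  rw [stirlingSum, Finset.sum_range_succ']
  simp

theorem stirlingSum_succ_succ (k d : ℕ) :
    stirlingSum (k + 1) (d + 1) = stirlingSum k (d + 1) + k * stirlingSum k d := by
  unfold stirlingSum
  rw [Finset.sum_range_succ', Finset.sum_range_succ' _ d, Finset.mul_sum]
  simp only [Nat.zero_le, if_true, Nat.sub_zero, Nat.stirlingFirst_self]
  rw [add_right_comm, ← Finset.sum_add_distrib]
  congr 1
  refine Finset.sum_congr rfl fun i _ => ?_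
  rcases lt_trichotomy i k with h | rfl | h
  · obtain ⟨j, rfl⟩ := Nat.exists_eq_add_of_lt h
    rw [if_pos (by omega), if_pos (by omega), if_pos (by omega),
      show i + j + 1 + 1 - (i + 1) = j + 1 by omega, show i + j + 1 - (i + 1) = j by omega,
      show i + j + 1 - i = j + 1 by omega, Nat.stirlingFirst_succ_succ, add_comm]
  -- At i = k the surviving term k · c(k, 0) vanishes: one of the factors is zero.
  · rw [if_pos le_rfl, if_neg (by omega), if_pos le_rfl, Nat.sub_self, Nat.sub_self]
    cases i <;> simp
  · simp [if_neg h.not_ge, show ¬ i + 1 ≤ k by omega]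

theorem ncard_signPatterns_congr {α V : Type*} {g : α → V → ℝ} {P Q : Set α} {X : Set V}
    (h₁ : ∀ x ∈ X, (∀ b ∈ P, g b x ≠ 0) ↔ ∀ b ∈ Q, g b x ≠ 0)
    (h₂ : ∀ x ∈ X, ∀ y ∈ X, (∀ b ∈ P, g b x ≠ 0) → (∀ b ∈ P, g b y ≠ 0) →
      ((∀ b ∈ P, 0 < g b x ↔ 0 < g b y) ↔ ∀ b ∈ Q, 0 < g b x ↔ 0 < g b y)) :
    (signPatterns g P X).ncard = (signPatterns g Q X).ncard := by
  have hd : {x ∈ X | ∀ b ∈ P, g b x ≠ 0} = {x ∈ X | ∀ b ∈ Q, g b x ≠ 0} := by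
    ext x; exact and_congr_right (h₁ x)
  unfold signPatterns
  rw [← hd]
  refine ncard_image_eq_of_forall_iff fun x hx y hy => ?_
  rw [sep_pos_eq_iff, sep_pos_eq_iff]
  exact h₂ x hx.1 y hy.1 hx.2 hy.2

section

variable {n k : ℕ}

/-- The affine function `x ↦ |x - p j|² - |x - p i|²`, where `ij = (i, j)`. -/
noncomputable def bisectorForm (p : Fin k → EuclideanSpace ℝ (Fin n)) (ij : Fin k × Fin k) :
    EuclideanSpace ℝ (Fin n) →ᵃ[ℝ] ℝ :=
  ((2 : ℝ) • (innerₛₗ ℝ (p ij.1 - p ij.2))).toAffineMap +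
    AffineMap.const ℝ _ (‖p ij.2‖ ^ 2 - ‖p ij.1‖ ^ 2)

theorem bisectorForm_apply (p : Fin k → EuclideanSpace ℝ (Fin n)) (ij : Fin k × Fin k)
    (x : EuclideanSpace ℝ (Fin n)) :
    bisectorForm p ij x = dist x (p ij.2) ^ 2 - dist x (p ij.1) ^ 2 := by
  rw [dist_eq_norm, dist_eq_norm, norm_sub_sq_real, norm_sub_sq_real]
  simp [bisectorForm, real_inner_comm]
  ring

theorem bisectorForm_pos {p : Fin k → EuclideanSpace ℝ (Fin n)} {ij : Fin k × Fin k}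
    {x : EuclideanSpace ℝ (Fin n)} :
    0 < bisectorForm p ij x ↔ dist x (p ij.1) < dist x (p ij.2) := by
  rw [bisectorForm_apply, sub_pos, sq_lt_sq₀ dist_nonneg dist_nonneg]

theorem bisectorForm_eq_zero {p : Fin k → EuclideanSpace ℝ (Fin n)} {ij : Fin k × Fin k}
    {x : EuclideanSpace ℝ (Fin n)} :
    bisectorForm p ij x = 0 ↔ dist x (p ij.1) = dist x (p ij.2) := by
  rw [bisectorForm_apply, sub_eq_zero, sq_eq_sq₀ dist_nonneg dist_nonneg, eq_comm]

theorem mem_bisectorFlat {p : Fin k → EuclideanSpace ℝ (Fin n)} {G : SimpleGraph (Fin k)}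
    {x : EuclideanSpace ℝ (Fin n)} :
    x ∈ bisectorFlat p G ↔ ∀ i j, G.Adj i j → dist x (p i) = dist x (p j) := by
  simp [bisectorFlat, AffineSubspace.mem_iInf_iff, AffineSubspace.mem_perpBisector_iff_dist_eq]

/-- The number of strict orders of the distances to the points `p i`, `i ∈ S`, at the points
of `X`. -/
noncomputable def orderCount (p : Fin k → EuclideanSpace ℝ (Fin n)) (S : Set (Fin k))
    (X : Set (EuclideanSpace ℝ (Fin n))) : ℕ :=
  (signPatterns (fun ij => ⇑(bisectorForm p ij)) S.offDiag X).ncard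

/-- The bisectors of a are added one by one. On H_ja the earlier pairs (i, a) have the signs of (i,
j), which lie in `S.offDiag`, so restriction leaves only the forms of S. -/
theorem orderCount_partial_insert (p : Fin k → EuclideanSpace ℝ (Fin n)) {S : Set (Fin k)}
    {a : Fin k} (ha : a ∉ S) (X : AffineSubspace ℝ (EuclideanSpace ℝ (Fin n)))
    (hX : ∀ j ∈ S, ∃ x ∈ X, dist x (p j) ≠ dist x (p a)) (T : Finset (Fin k))
    (hT : (T : Set (Fin k)) ⊆ S) :
    (signPatterns (fun ij => ⇑(bisectorForm p ij)) (S.offDiag ∪ (T : Set (Fin k)) ×ˢ {a})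
      (X : Set (EuclideanSpace ℝ (Fin n)))).ncard =
      orderCount p S X +
        ∑ j ∈ T, orderCount p S {x ∈ (X : Set (EuclideanSpace ℝ (Fin n))) |
          dist x (p j) = dist x (p a)} := by
  induction T using Finset.induction_on with
  | empty => simp [orderCount]
  | insert j T hj ih =>
    rw [Finset.coe_insert, Set.insert_subset_iff] at hT
    have e : S.offDiag ∪ ((insert j T : Finset (Fin k)) : Set (Fin k)) ×ˢ {a} =
        insert (j, a) (S.offDiag ∪ (T : Set (Fin k)) ×ˢ {a}) := by
      ext ⟨i, l⟩
      simp only [mem_union, mem_offDiag, mem_prod, Finset.coe_insert, mem_insert_iff,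
        mem_singleton_iff, Prod.mk.injEq]
      tauto
    have hn : (j, a) ∉ S.offDiag ∪ (T : Set (Fin k)) ×ˢ {a} := by
      simp [ha, hj]
    obtain ⟨x, hx, hxj⟩ := hX j hT.1
    rw [e, ncard_signPatterns_insert _ X hn ⟨x, hx, by rwa [Ne, bisectorForm_eq_zero]⟩,
      ih hT.2, Finset.sum_insert hj]
    simp only [bisectorForm_eq_zero]
    rw [add_assoc, add_comm (Finset.sum _ _), orderCount, orderCount]
    congr 2
    have hij : ∀ i ∈ T, (i, j) ∈ S.offDiag := fun i hi =>
      ⟨hT.2 hi, hT.1, fun h => hj (by rwa [← show i = j from h])⟩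
    refine ncard_signPatterns_congr ?_ ?_
    · rintro x ⟨-, hx⟩
      simp only [Ne, bisectorForm_eq_zero]
      refine ⟨fun h b hb => h b (Or.inl hb), ?_⟩
      rintro h ⟨i, l⟩ (hb | ⟨hi, hl⟩)
      · exact h _ hb
      · obtain rfl : l = a := hl
        exact hx ▸ h _ (hij i hi)
    · rintro x ⟨-, hx⟩ y ⟨-, hy⟩ - -
      simp only [bisectorForm_pos]
      refine ⟨fun h b hb => h b (Or.inl hb), ?_⟩
      rintro h ⟨i, l⟩ (hb | ⟨hi, hl⟩)
      · exact h _ hb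
      · obtain rfl : l = a := hl
        have := h _ (hij i hi)
        dsimp only at this hx hy ⊢
        rwa [← hx, ← hy]

theorem orderCount_insert (p : Fin k → EuclideanSpace ℝ (Fin n)) (S : Finset (Fin k))
    {a : Fin k} (ha : a ∉ S) (X : AffineSubspace ℝ (EuclideanSpace ℝ (Fin n)))
    (hX : ∀ j ∈ S, ∃ x ∈ X, dist x (p j) ≠ dist x (p a)) :
    orderCount p (insert a (S : Set (Fin k))) X =
      orderCount p S X +
        ∑ j ∈ S, orderCount p S {x ∈ (X : Set (EuclideanSpace ℝ (Fin n))) |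
          dist x (p j) = dist x (p a)} := by
  rw [← orderCount_partial_insert p (S := S) ha X hX S subset_rfl, orderCount]
  have hja : ∀ j ∈ S, j ≠ a := fun j hj h => ha (h ▸ hj)
  refine ncard_signPatterns_congr ?_ ?_
  · intro x _
    simp only [Ne, bisectorForm_eq_zero]
    constructor
    · rintro h ⟨i, l⟩ (⟨hi, hl, hil⟩ | ⟨hi, hl⟩)
      · exact h (i, l) ⟨Or.inr hi, Or.inr hl, hil⟩
      · obtain rfl : l = a := hl
        exact h (i, l) ⟨Or.inr hi, Or.inl rfl, hja _ hi⟩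
    · rintro h ⟨i, l⟩ ⟨hi | hi, hl | hl, hil⟩
      · exact absurd (hi.trans hl.symm) hil
      · obtain rfl : i = a := hi
        exact fun e => h (l, i) (Or.inr ⟨hl, rfl⟩) e.symm
      · exact h (i, l) (Or.inr ⟨hi, hl⟩)
      · exact h (i, l) (Or.inl ⟨hi, hl, hil⟩)
  · intro x _ y _ hx hy
    simp only [bisectorForm_pos]
    constructor
    · rintro h ⟨i, l⟩ (⟨hi, hl, hil⟩ | ⟨hi, hl⟩)
      · exact h (i, l) ⟨Or.inr hi, Or.inr hl, hil⟩
      · obtain rfl : l = a := hl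
        exact h (i, l) ⟨Or.inr hi, Or.inl rfl, hja _ hi⟩
    · rintro h ⟨i, l⟩ ⟨hi | hi, hl | hl, hil⟩
      · exact absurd (hi.trans hl.symm) hil
      · obtain rfl : i = a := hi
        -- The form of (a, l) is the negative of that of (l, a); as neither vanishes at x or y, one
        -- sign settles the other.
        have h1 := h (l, i) (Or.inr ⟨hl, rfl⟩)
        have hx' := hx (i, l) ⟨Or.inl rfl, Or.inr hl, hil⟩
        have hy' := hy (i, l) ⟨Or.inl rfl, Or.inr hl, hil⟩
        rw [Ne, bisectorForm_eq_zero] at hx' hy'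
        dsimp only at h1 hx' hy' ⊢
        rw [← not_le, ← not_le, not_iff_not, le_iff_lt_or_eq, le_iff_lt_or_eq, h1,
          or_iff_left (Ne.symm hx'), or_iff_left (Ne.symm hy')]
      · exact h (i, l) (Or.inr ⟨hi, hl⟩)
      · exact h (i, l) (Or.inl ⟨hi, hl, hil⟩)

theorem reachable_sup_edge {V : Type*} {G : SimpleGraph V} {a b x y : V}
    (h : (G ⊔ SimpleGraph.edge a b).Reachable x y) :
    G.Reachable x y ∨ (G.Reachable x a ∧ G.Reachable b y) ∨
      (G.Reachable x b ∧ G.Reachable a y) := by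
  obtain ⟨w⟩ := h
  induction w with
  | nil => exact Or.inl (SimpleGraph.Reachable.refl _)
  | cons hadj w ih =>
    rcases hadj with hadj | hadj
    · rcases ih with h | ⟨h, h'⟩ | ⟨h, h'⟩
      · exact Or.inl (hadj.reachable.trans h)
      · exact Or.inr (Or.inl ⟨hadj.reachable.trans h, h'⟩)
      · exact Or.inr (Or.inr ⟨hadj.reachable.trans h, h'⟩)
    · rw [SimpleGraph.edge_adj] at hadj
      have r := fun x => SimpleGraph.Reachable.refl (G := G) x
      obtain ⟨⟨rfl, rfl⟩ | ⟨rfl, rfl⟩, -⟩ := hadj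
      · rcases ih with h | ⟨h, h'⟩ | ⟨h, h'⟩
        · exact Or.inr (Or.inl ⟨r _, h⟩)
        · exact Or.inr (Or.inl ⟨r _, h'⟩)
        · exact Or.inl h'
      · rcases ih with h | ⟨h, h'⟩ | ⟨h, h'⟩
        · exact Or.inr (Or.inr ⟨r _, h⟩)
        · exact Or.inl h'
        · exact Or.inr (Or.inr ⟨r _, h'⟩)

theorem edgeSet_sup_edge {V : Type*} (G : SimpleGraph V) {a b : V} (hab : a ≠ b) :
    (G ⊔ SimpleGraph.edge a b).edgeSet = insert s(a, b) G.edgeSet := by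
  rw [SimpleGraph.edgeSet_sup, SimpleGraph.edgeSet_edge_of_ne hab, Set.union_comm]
  rfl

theorem mem_bisectorFlat_sup_edge {p : Fin k → EuclideanSpace ℝ (Fin n)}
    {G : SimpleGraph (Fin k)} {a b : Fin k} (hab : a ≠ b) {x : EuclideanSpace ℝ (Fin n)} :
    x ∈ bisectorFlat p (G ⊔ SimpleGraph.edge a b) ↔
      x ∈ bisectorFlat p G ∧ dist x (p a) = dist x (p b) := by
  simp only [mem_bisectorFlat, SimpleGraph.sup_adj, SimpleGraph.edge_adj]
  constructor
  · exact fun h => ⟨fun i j hij => h i j (Or.inl hij), h a b (Or.inr ⟨Or.inl ⟨rfl, rfl⟩, hab⟩)⟩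
  · rintro ⟨h, h'⟩ i j (hij | ⟨⟨rfl, rfl⟩ | ⟨rfl, rfl⟩, -⟩)
    exacts [h i j hij, h', h'.symm]

/-- Induction needs all forests G separating the points of S, since restriction to H_ja adds the
edge ja. With n + 1 edges the flat is empty and the Stirling sum has no terms. -/
theorem IsGeneric.orderCount_bisectorFlat {p : Fin k → EuclideanSpace ℝ (Fin n)}
    (hp : IsGeneric p) (S : Finset (Fin k)) :
    ∀ G : SimpleGraph (Fin k), G.IsAcyclic → G.edgeSet.ncard ≤ n + 1 →
      (∀ i ∈ S, ∀ j ∈ S, i ≠ j → ¬ G.Reachable i j) →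
      orderCount p S (bisectorFlat p G) = stirlingSum S.card (n + 1 - G.edgeSet.ncard) := by
  induction S using Finset.induction_on with
  | empty =>
    intro G hG hm _
    rcases Nat.lt_or_ge n G.edgeSet.ncard with h | h
    · rw [hp.not_intersect G hG (by omega), Nat.sub_eq_zero_of_le (by omega)]
      simp [orderCount, signPatterns, stirlingSum]
    · rw [Nat.succ_sub h, Finset.card_empty, stirlingSum_zero_succ]
      simp [orderCount, signPatterns, (hp.codim G hG h).1]
  | insert a S ha ih =>
    intro G hG hm hS
    rcases Nat.lt_or_ge n G.edgeSet.ncard with h | h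
    · rw [hp.not_intersect G hG (by omega), Nat.sub_eq_zero_of_le (by omega)]
      simp [orderCount, signPatterns, stirlingSum]
    have hja : ∀ j ∈ S, j ≠ a := fun j hj h => ha (h ▸ hj)
    have hr : ∀ j ∈ S, ¬ G.Reachable j a := fun j hj =>
      hS j (Finset.mem_insert_of_mem hj) a (Finset.mem_insert_self _ _) (hja j hj)
    have hac : ∀ j ∈ S, (G ⊔ SimpleGraph.edge j a).IsAcyclic := fun j hj =>
      hG.sup_edge_of_not_reachable (hr j hj)
    have hcard : ∀ j ∈ S, (G ⊔ SimpleGraph.edge j a).edgeSet.ncard = G.edgeSet.ncard + 1 := by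
      intro j hj
      rw [edgeSet_sup_edge G (hja j hj), Set.ncard_insert_of_notMem]
      exact fun hadj => hr j hj (SimpleGraph.Adj.reachable hadj)
    -- If the flat lay inside H_ja, the extra edge would not change it, contradicting the drop in
    -- dimension, or emptiness when G has n edges.
    have hX : ∀ j ∈ S, ∃ x ∈ bisectorFlat p G, dist x (p j) ≠ dist x (p a) := by
      intro j hj
      by_contra! hc
      have e : bisectorFlat p (G ⊔ SimpleGraph.edge j a) = bisectorFlat p G := by
        ext x
        rw [mem_bisectorFlat_sup_edge (hja j hj)]
        exact ⟨fun h => h.1, fun h => ⟨h, hc x h⟩⟩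
      have h1 := hp.codim G hG h
      rcases h.eq_or_lt with h | h
      · have := hp.not_intersect _ (hac j hj) (by rw [hcard j hj, h])
        rw [e] at this
        exact h1.1.ne_empty this
      · have := (hp.codim _ (hac j hj) (by rw [hcard j hj]; omega)).2
        rw [e, hcard j hj] at this
        omega
    have hflat : ∀ j ∈ S, {x ∈ (bisectorFlat p G : Set (EuclideanSpace ℝ (Fin n))) |
        dist x (p j) = dist x (p a)} = bisectorFlat p (G ⊔ SimpleGraph.edge j a) := by
      intro j hj
      ext x
      exact (mem_bisectorFlat_sup_edge (hja j hj)).symm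
    rw [Finset.coe_insert, orderCount_insert p S ha _ hX, Finset.card_insert_of_notMem ha,
      Nat.succ_sub h, stirlingSum_succ_succ, ih G hG hm fun i hi j hj =>
        hS i (Finset.mem_insert_of_mem hi) j (Finset.mem_insert_of_mem hj), Nat.succ_sub h]
    congr 1
    rw [← smul_eq_mul]
    refine Finset.sum_eq_card_nsmul fun j hj => ?_
    rw [hflat j hj, ih _ (hac j hj) (by rw [hcard j hj]; omega), hcard j hj, Nat.add_sub_add_right]
    -- A path using the new edge would connect i or l to a within G.
    intro i hi l hl hil hreach
    have hi' := hr i hi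
    have hl' := hr l hl
    rcases reachable_sup_edge hreach with h | ⟨-, h⟩ | ⟨h, -⟩
    · exact hS i (Finset.mem_insert_of_mem hi) l (Finset.mem_insert_of_mem hl) hil h
    · exact hl' h.symm
    · exact hi' h

end


/-! ### Regions and observable orders as sign patterns -/

section

variable {n k : ℕ} {p : Fin k → EuclideanSpace ℝ (Fin n)}

theorem mem_bisectorComplement {x : EuclideanSpace ℝ (Fin n)} :
    x ∈ bisectorComplement p ↔
      ∀ b ∈ (Set.univ : Set (Fin k)).offDiag, bisectorForm p b x ≠ 0 := by
  simp only [bisectorComplement, Set.mem_ofPred_eq, AffineSubspace.mem_perpBisector_iff_dist_eq,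
    Ne, bisectorForm_eq_zero]
  constructor
  · rintro h ⟨i, j⟩ ⟨-, -, hij⟩
    rcases lt_or_gt_of_ne hij with hij | hij
    · exact h i j hij
    · exact fun e => h j i hij e.symm
  · exact fun h i j hij => h (i, j) ⟨trivial, trivial, hij.ne⟩

theorem ncard_image_bisectorComplement {β : Type*} {f : EuclideanSpace ℝ (Fin n) → β}
    (h : ∀ x ∈ bisectorComplement p, ∀ y ∈ bisectorComplement p,
      f x = f y ↔ ∀ b ∈ (Set.univ : Set (Fin k)).offDiag,
        0 < bisectorForm p b x ↔ 0 < bisectorForm p b y) :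
    (f '' bisectorComplement p).ncard = orderCount p Set.univ Set.univ := by
  have e : {x ∈ (Set.univ : Set (EuclideanSpace ℝ (Fin n))) |
      ∀ b ∈ (Set.univ : Set (Fin k)).offDiag, bisectorForm p b x ≠ 0} = bisectorComplement p := by
    ext x
    rw [mem_bisectorComplement]
    simp
  rw [orderCount, signPatterns, e]
  refine ncard_image_eq_of_forall_iff fun x hx y hy => ?_
  rw [h x hx y hy, sep_pos_eq_iff]

theorem continuous_bisectorForm (b : Fin k × Fin k) : Continuous (bisectorForm p b) :=
  AffineMap.continuous_of_finiteDimensional _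

/-- Signs are constant on a component by the intermediate value theorem; conversely, points with
equal signs share a convex cell. -/
theorem connectedComponentIn_bisectorComplement_eq_iff {x y : EuclideanSpace ℝ (Fin n)}
    (hx : x ∈ bisectorComplement p) (hy : y ∈ bisectorComplement p) :
    connectedComponentIn (bisectorComplement p) x = connectedComponentIn (bisectorComplement p) y ↔
      ∀ b ∈ (Set.univ : Set (Fin k)).offDiag,
        0 < bisectorForm p b x ↔ 0 < bisectorForm p b y := by
  constructor
  · intro h b hb
    have hsub := connectedComponentIn_subset (bisectorComplement p) x
    have hpre := isPreconnected_connectedComponentIn (x := x) (F := bisectorComplement p)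
    have hx' := mem_connectedComponentIn hx
    have hy' := mem_connectedComponentIn hy
    rw [← h] at hy'
    have key : ∀ u ∈ connectedComponentIn (bisectorComplement p) x,
        ∀ w ∈ connectedComponentIn (bisectorComplement p) x,
        0 < bisectorForm p b u → 0 < bisectorForm p b w := by
      intro u hu w hw hpos
      by_contra hneg
      obtain ⟨z, hz, hz0⟩ := hpre.intermediate_value hw hu
        (continuous_bisectorForm b).continuousOn ⟨not_lt.1 hneg, hpos.le⟩
      exact mem_bisectorComplement.1 (hsub hz) b hb hz0
    exact ⟨key x hx' y hy', key y hy' x hx'⟩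
  · intro h
    -- Positive forms suffice: a negative form becomes positive when its pair is reversed.
    set cell := ⋂ b ∈ {b ∈ (Set.univ : Set (Fin k)).offDiag | 0 < bisectorForm p b x},
      bisectorForm p b ⁻¹' Set.Ioi 0
    have hconv : Convex ℝ cell :=
      convex_iInter₂ fun b _ => (convex_Ioi 0).affine_preimage (bisectorForm p b)
    have hsub : cell ⊆ bisectorComplement p := by
      intro z hz
      rw [mem_bisectorComplement]
      simp only [cell, Set.mem_iInter] at hz
      rintro ⟨i, j⟩ hb
      rcases (mem_bisectorComplement.1 hx _ hb).lt_or_gt with hlt | hlt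
      · have h1 : 0 < bisectorForm p (j, i) x := by
          rw [bisectorForm_apply] at hlt ⊢; dsimp only at hlt ⊢; linarith
        have h2 : 0 < bisectorForm p (j, i) z := hz _ ⟨⟨trivial, trivial, hb.2.2.symm⟩, h1⟩
        rw [bisectorForm_apply] at h2 ⊢
        dsimp only at h2 ⊢
        exact ne_of_lt (by linarith)
      · exact ne_of_gt (hz _ ⟨hb, hlt⟩)
    have hxc : x ∈ cell := Set.mem_iInter₂.2 fun b hb => hb.2
    have hyc : y ∈ cell := Set.mem_iInter₂.2 fun b hb => (h b hb.1).1 hb.2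
    exact connectedComponentIn_eq
      (hconv.isPreconnected.subset_connectedComponentIn hxc hsub hyc)

theorem ncard_regions : (regions p).ncard = orderCount p Set.univ Set.univ := by
  rw [← ncard_image_bisectorComplement (p := p) fun x hx y hy =>
    connectedComponentIn_bisectorComplement_eq_iff hx hy]
  congr 1
  ext R
  simp [regions, eq_comm]

theorem sort_eq_sort_iff {f g : Fin k → ℝ} (hf : Function.Injective f)
    (hg : Function.Injective g) :
    Tuple.sort f = Tuple.sort g ↔ ∀ i j, f i < f j ↔ g i < g j := by
  have key : ∀ f : Fin k → ℝ, Function.Injective f → StrictMono (f ∘ Tuple.sort f) :=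
    fun f hf => (Tuple.monotone_sort f).strictMono_of_injective (hf.comp (Tuple.sort f).injective)
  constructor
  · intro h i j
    obtain ⟨i, rfl⟩ := (Tuple.sort f).surjective i
    obtain ⟨j, rfl⟩ := (Tuple.sort f).surjective j
    have h1 := (key f hf).lt_iff_lt (a := i) (b := j)
    have h2 := (key g hg).lt_iff_lt (a := i) (b := j)
    rw [← h] at h2
    exact h1.trans h2.symm
  · intro h
    refine Tuple.eq_sort_iff.2 ⟨?_, ?_⟩
    · exact StrictMono.monotone fun i j hij => (h _ _).1 (key f hf hij)
    · intro i j hij e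
      exact absurd ((Tuple.sort f).injective (hg e)) hij.ne

theorem injective_dist {x : EuclideanSpace ℝ (Fin n)} :
    Function.Injective (fun i => dist x (p i)) ↔ x ∈ bisectorComplement p := by
  rw [mem_bisectorComplement]
  simp only [Ne, bisectorForm_eq_zero]
  constructor
  · exact fun h b hb e => hb.2.2 (h e)
  · intro h i j e
    by_contra hij
    exact h (i, j) ⟨trivial, trivial, hij⟩ e

theorem ncard_observableOrders :
    (observableOrders p).ncard = orderCount p Set.univ Set.univ := by
  rw [← ncard_image_bisectorComplement (p := p) (f := fun x => Tuple.sort fun i => dist x (p i))]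
  · congr 1
    ext σ
    constructor
    · rintro ⟨x, hx⟩
      have hinj : Function.Injective fun i => dist x (p i) := by
        have := hx.injective.comp σ.symm.injective
        simpa [Function.comp_def] using this
      refine ⟨x, injective_dist.1 hinj, (Tuple.eq_sort_iff.2 ⟨hx.monotone, ?_⟩).symm⟩
      exact fun i j hij e => absurd (hx.injective e) hij.ne
    · rintro ⟨x, hx, rfl⟩
      exact ⟨x, (Tuple.monotone_sort _).strictMono_of_injective
        ((injective_dist.2 hx).comp (Tuple.sort _).injective)⟩
  · intro x hx y hy
    rw [sort_eq_sort_iff (injective_dist.2 hx) (injective_dist.2 hy)]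
    simp only [bisectorForm_pos]
    refine ⟨fun h b _ => h _ _, fun h i j => ?_⟩
    by_cases hij : i = j
    · simp [hij]
    · exact h (i, j) ⟨trivial, trivial, hij⟩

theorem IsGeneric.ncard_regions (hp : IsGeneric p) :
    (regions p).ncard = stirlingSum k (n + 1) := by
  have h := hp.orderCount_bisectorFlat Finset.univ ⊥ SimpleGraph.isAcyclic_bot (by simp)
    (fun i _ j _ hij => by simpa using hij)
  have e : (bisectorFlat p ⊥ : Set (EuclideanSpace ℝ (Fin n))) = Set.univ := by
    ext x; exact iff_of_true (mem_bisectorFlat.2 fun i j h => h.elim) trivial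
  rw [GoodTideman.ncard_regions, ← Finset.coe_univ (α := Fin k), ← e, h]
  simp

end


/-! ### Almost all tuples are generic -/

theorem exists_leaf_of_isAcyclic {V : Type*} [Finite V] {G : SimpleGraph V} (hG : G.IsAcyclic)
    {a b : V} (hab : G.Adj a b) : ∃ v u, G.Adj v u ∧ ∀ w, G.Adj v w → w = u := by
  classical
  set c := G.connectedComponentMk a
  have ha : a ∈ c.supp := rfl
  have hb : b ∈ c.supp := SimpleGraph.ConnectedComponent.sound hab.reachable.symm
  have : Nontrivial c := ⟨⟨⟨a, ha⟩, ⟨b, hb⟩, fun h => hab.ne (congrArg Subtype.val h)⟩⟩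
  have := Fintype.ofFinite c
  obtain ⟨v, hv⟩ := (hG.isTree_connectedComponent c).exists_vert_degree_one_of_nontrivial
  obtain ⟨u, hu, huniq⟩ := SimpleGraph.degree_eq_one_iff_existsUnique_adj.1 hv
  refine ⟨v, u, hu, fun w hw => ?_⟩
  have hwc : w ∈ c.supp :=
    (SimpleGraph.ConnectedComponent.sound hw.reachable.symm).trans v.2
  exact congrArg Subtype.val (huniq ⟨w, hwc⟩ hw)

theorem ae_of_ae_ae_update {E : Type*} [MeasureSpace E] [SigmaFinite (volume : Measure E)]
    [NeZero (volume : Measure E)] {k : ℕ} (v : Fin k) {s : Set (Fin k → E)} (hs : MeasurableSet s)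
    (h : ∀ᵐ p : Fin k → E, ∀ᵐ y : E, Function.update p v y ∈ s) : ∀ᵐ p : Fin k → E, p ∈ s := by
  obtain _ | k := k
  · exact v.elim0
  set e := MeasurableEquiv.piFinSuccAbove (fun _ : Fin (k + 1) => E) v
  have he : MeasurePreserving e := volume_preserving_piFinSuccAbove (fun _ => E) v
  have hup : ∀ x q y, Function.update (e.symm (x, q)) v y = e.symm (y, q) := by
    intro x q y
    exact Fin.update_insertNth (α := fun _ => E) v x y q
  have h1 := he.symm.quasiMeasurePreserving.ae h
  -- Updating at v forgets the old coordinate x, so a single good value of x is enough.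
  obtain ⟨x, hx⟩ := (Measure.ae_ae_of_ae_prod h1).exists
  simp only [hup] at hx
  have hm : MeasurableSet {z : E × (Fin k → E) | e.symm z ∈ s} := e.symm.measurable hs
  have h2 : ∀ᵐ z : E × (Fin k → E), e.symm z ∈ s :=
    (Measure.ae_prod_iff_ae_ae hm).2 ((Measure.ae_ae_comm hm).2 hx)
  simpa using he.quasiMeasurePreserving.ae h2

section

variable {n k : ℕ} {W : Type*} [NormedAddCommGroup W] [NormedSpace ℝ W]

/-- The difference of `φ` at the two endpoints of an edge, with an arbitrary orientation. -/
noncomputable def edgeDiff {E : Type*} (φ : E → W) (p : Fin k → E) (e : Sym2 (Fin k)) : W :=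
  φ (p (Quot.out e).1) - φ (p (Quot.out e).2)

theorem mk_out {α : Type*} (e : Sym2 α) : s((Quot.out e).1, (Quot.out e).2) = e := Quot.out_eq e

/-- Only the leaf edge vu involves `p v`. The other m < dim W differences lie in the kernel of some
f ≠ 0, so dependence forces f (φ y) = f (φ (p u)), a null condition on the new position y of v. -/
theorem ae_linearIndepOn_edgeDiff [Nontrivial (EuclideanSpace ℝ (Fin n))]
    {φ : EuclideanSpace ℝ (Fin n) → W} (hφ : Continuous φ)
    (hnull : ∀ f : W →ₗ[ℝ] ℝ, f ≠ 0 → ∀ c, ∀ᵐ x, f (φ x) ≠ c) (m : ℕ) :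
    ∀ G : SimpleGraph (Fin k), G.IsAcyclic → G.edgeSet.ncard = m → m ≤ Module.finrank ℝ W →
      ∀ᵐ p : Fin k → EuclideanSpace ℝ (Fin n), LinearIndepOn ℝ (edgeDiff φ p) G.edgeSet := by
  induction m with
  | zero =>
    intro G _ hm _
    rw [Set.ncard_eq_zero] at hm
    rw [hm]
    exact ae_of_all _ fun p => linearIndepOn_empty ℝ _
  | succ m ih =>
    intro G hG hm hW
    obtain ⟨e, he⟩ := Set.nonempty_of_ncard_ne_zero (s := G.edgeSet) (by omega)
    induction e with | _ a b
    obtain ⟨v, u, hvu, huniq⟩ := exists_leaf_of_isAcyclic hG he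
    set G' := G.deleteEdges {s(v, u)} with hG'
    have hGe : G'.edgeSet = G.edgeSet \ {s(v, u)} := G.edgeSet_deleteEdges _
    have hmem : s(v, u) ∈ G.edgeSet := hvu
    have hins : G.edgeSet = insert s(v, u) G'.edgeSet := by
      rw [hGe, Set.insert_sdiff_singleton, Set.insert_eq_of_mem hmem]
    have hnot : s(v, u) ∉ G'.edgeSet := by rw [hGe]; simp
    have hm' : G'.edgeSet.ncard = m := by
      rw [hins, Set.ncard_insert_of_notMem hnot] at hm; omega
    have hv : ∀ e ∈ G'.edgeSet, v ∉ e := by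
      intro e he hve
      obtain ⟨w, rfl⟩ := hve
      rw [hGe] at he
      exact he.2 (by rw [huniq w he.1]; rfl)
    have hdiff : ∀ (p : Fin k → EuclideanSpace ℝ (Fin n)) y, Set.EqOn (edgeDiff φ p)
        (edgeDiff φ (Function.update p v y)) G'.edgeSet := by
      intro p y e he
      have h1 : (Quot.out e).1 ≠ v := fun h => hv e he (h ▸ Sym2.out_fst_mem e)
      have h2 : (Quot.out e).2 ≠ v := fun h => hv e he (h ▸ Sym2.out_snd_mem e)
      rw [edgeDiff, edgeDiff, Function.update_of_ne h1, Function.update_of_ne h2]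
    refine ae_of_ae_ae_update v (s := {p | LinearIndepOn ℝ (edgeDiff φ p) G.edgeSet}) ?_ ?_
    · have hc : Continuous fun (p : Fin k → EuclideanSpace ℝ (Fin n)) (e : G.edgeSet) =>
          edgeDiff φ p e := by
        unfold edgeDiff; fun_prop
      exact ((isOpen_setOfPred_linearIndependent (𝕜 := ℝ) (E := W)).preimage hc).measurableSet
    filter_upwards [ih G' (hG.anti (G.deleteEdges_le _)) hm' (by omega)] with p hp
    have hspan : Submodule.span ℝ (edgeDiff φ p '' G'.edgeSet) < ⊤ := by
      refine lt_top_iff_ne_top.2 fun h => ?_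
      have := Fintype.ofFinite (edgeDiff φ p '' G'.edgeSet)
      have h1 := (Set.ncard_image_le (f := edgeDiff φ p) G'.edgeSet.toFinite)
      have h2 := finrank_span_le_card (R := ℝ) (edgeDiff φ p '' G'.edgeSet)
      rw [h, finrank_top, ← Set.ncard_eq_toFinset_card'] at h2
      omega
    obtain ⟨f, hf, hker⟩ := Submodule.exists_le_ker_of_lt_top _ hspan
    filter_upwards [hnull f hf (f (φ (p u)))] with y hy
    show LinearIndepOn ℝ _ _
    rw [hins, linearIndepOn_insert hnot, ← (hdiff p y).image_eq]
    refine ⟨hp.congr (hdiff p y), fun hsp => hy ?_⟩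
    have h0 : f (edgeDiff φ (Function.update p v y) s(v, u)) = 0 := hker hsp
    have hout := mk_out s(v, u)
    rw [Sym2.eq_iff] at hout
    rcases hout with ⟨h1, h2⟩ | ⟨h1, h2⟩ <;>
      rw [edgeDiff, h1, h2, Function.update_self, Function.update_of_ne hvu.ne', map_sub,
        sub_eq_zero] at h0
    exacts [h0, h0.symm]

theorem ae_linearMap_ne {E : Type*} [NormedAddCommGroup E] [NormedSpace ℝ E] [MeasureSpace E]
    [BorelSpace E] [FiniteDimensional ℝ E] [(volume : Measure E).IsAddHaarMeasure]
    (f : E →ₗ[ℝ] ℝ) (hf : f ≠ 0) (c : ℝ) : ∀ᵐ x, f x ≠ c := by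
  set s : AffineSubspace ℝ E := (AffineSubspace.mk' c ⊥).comap f.toAffineMap
  have hs : ∀ x, x ∈ s ↔ f x = c := by
    intro x
    simp [s, AffineSubspace.mem_comap, AffineSubspace.mem_mk', sub_eq_zero]
  have hne : s ≠ ⊤ := by
    intro h
    have h0 : ∀ x, f x = c := fun x => (hs x).1 (h ▸ AffineSubspace.mem_top ℝ E x)
    refine hf (LinearMap.ext fun x => ?_)
    rw [h0 x, ← h0 0, map_zero, LinearMap.zero_apply]
  have := Measure.addHaar_affineSubspace volume s hne
  rw [ae_iff]
  convert this using 2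
  ext x
  simpa using (hs x).symm

theorem ae_linearMap_norm_sq_ne {E : Type*} [NormedAddCommGroup E] [InnerProductSpace ℝ E]
    [MeasureSpace E] [BorelSpace E] [FiniteDimensional ℝ E] [Nontrivial E]
    [(volume : Measure E).IsAddHaarMeasure] (f : E × ℝ →ₗ[ℝ] ℝ) (hf : f ≠ 0) (c : ℝ) :
    ∀ᵐ x : E, f (x, ‖x‖ ^ 2) ≠ c := by
  set g : E →ₗ[ℝ] ℝ := f ∘ₗ LinearMap.inl ℝ E ℝ
  set b : ℝ := f (0, 1)
  have hfg : ∀ x t, f (x, t) = g x + t * b := by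
    intro x t
    have : (x, t) = (x, 0) + t • ((0 : E), (1 : ℝ)) := by simp
    rw [this, map_add, map_smul]
    rfl
  simp only [hfg]
  by_cases hb : b = 0
  · simp only [hb, mul_zero, add_zero]
    refine ae_linearMap_ne g (fun hg => hf ?_) c
    refine LinearMap.ext fun z => ?_
    rw [hfg z.1 z.2, hg, hb]
    simp
  · set a := (InnerProductSpace.toDual ℝ E).symm g.toContinuousLinearMap
    have ha : ∀ x, g x = inner ℝ x a := by
      intro x
      rw [real_inner_comm, InnerProductSpace.toDual_symm_apply]
      rfl
    -- Completing the square in ⟨x, a⟩ + b|x|² = c gives a sphere with this centre.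
    set z : E := (-(1 / (2 * b))) • a
    have hnull := Measure.addHaar_sphere (volume : Measure E) z (√(c / b + ‖z‖ ^ 2))
    rw [ae_iff]
    refine measure_mono_null (fun x hx => ?_) hnull
    have hx' : g x + ‖x‖ ^ 2 * b = c := by simpa using hx
    rw [Metric.mem_sphere, dist_eq_norm, ← Real.sqrt_sq (norm_nonneg (x - z)), norm_sub_sq_real]
    congr 1
    rw [← hx', ha, real_inner_smul_right]
    field_simp
    ring

theorem dist_eq_dist_iff_inner {E : Type*} [NormedAddCommGroup E] [InnerProductSpace ℝ E]
    {x a b : E} : dist x a = dist x b ↔ 2 * inner ℝ (a - b) x = ‖a‖ ^ 2 - ‖b‖ ^ 2 := by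
  rw [← sq_eq_sq₀ dist_nonneg dist_nonneg, dist_eq_norm, dist_eq_norm, norm_sub_sq_real,
    norm_sub_sq_real, inner_sub_left, real_inner_comm x a, real_inner_comm x b]
  constructor <;> intro h <;> linarith

theorem mem_bisectorFlat_iff_inner {p : Fin k → EuclideanSpace ℝ (Fin n)}
    {G : SimpleGraph (Fin k)} {x : EuclideanSpace ℝ (Fin n)} :
    x ∈ bisectorFlat p G ↔ ∀ e ∈ G.edgeSet,
      2 * inner ℝ (edgeDiff id p e) x = edgeDiff (fun y => ‖y‖ ^ 2) p e := by
  rw [mem_bisectorFlat]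
  simp only [edgeDiff, id_eq, ← dist_eq_dist_iff_inner]
  constructor
  · intro h e he
    rw [← mk_out e] at he
    exact h _ _ he
  · intro h i j hij
    have h1 := h s(i, j) hij
    have hout := mk_out s(i, j)
    rw [Sym2.eq_iff] at hout
    rcases hout with ⟨h2, h3⟩ | ⟨h2, h3⟩ <;> rw [h2, h3] at h1
    exacts [h1, h1.symm]

/-- A common point x makes the functional (y, t) ↦ 2⟨x, y⟩ - t vanish on n + 1 independent vectors
of ℝⁿ × ℝ, hence everywhere, yet its value at (0, 1) is -1. -/
theorem bisectorFlat_eq_empty {p : Fin k → EuclideanSpace ℝ (Fin n)} {G : SimpleGraph (Fin k)}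
    (h : LinearIndepOn ℝ (edgeDiff (fun y => (y, ‖y‖ ^ 2)) p) G.edgeSet)
    (hm : G.edgeSet.ncard = n + 1) :
    (bisectorFlat p G : Set (EuclideanSpace ℝ (Fin n))) = ∅ := by
  refine Set.eq_empty_of_forall_notMem fun x hx => ?_
  rw [SetLike.mem_coe, mem_bisectorFlat_iff_inner] at hx
  have := Fintype.ofFinite G.edgeSet
  have htop := LinearIndependent.span_eq_top_of_card_eq_finrank' h (by
    rw [← Nat.card_eq_fintype_card, Nat.card_coe_set_eq, hm]; simp)
  set f : EuclideanSpace ℝ (Fin n) × ℝ →ₗ[ℝ] ℝ :=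
    (2 : ℝ) • (innerₛₗ ℝ x) ∘ₗ LinearMap.fst ℝ _ _ - LinearMap.snd ℝ _ _
  have hf : ∀ z, f z = 2 * inner ℝ x z.1 - z.2 := fun z => by simp [f]
  have hker : (⊤ : Submodule ℝ (EuclideanSpace ℝ (Fin n) × ℝ)) ≤ LinearMap.ker f := by
    rw [← htop, Submodule.span_le]
    rintro _ ⟨⟨e, he⟩, rfl⟩
    have := hx e he
    rw [SetLike.mem_coe, LinearMap.mem_ker, hf, real_inner_comm]
    simp only [edgeDiff, id_eq, Prod.mk_sub_mk] at this ⊢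
    rw [this, sub_self]
  have h1 := hker (Submodule.mem_top (x := (0, 1)))
  rw [LinearMap.mem_ker, hf] at h1
  simp at h1

/-- The flat is the solution set of a linear system with independent rows: the map L is onto, and
its kernel is the orthogonal complement of the rows. -/
theorem bisectorFlat_nonempty_and_finrank {p : Fin k → EuclideanSpace ℝ (Fin n)}
    {G : SimpleGraph (Fin k)} (h : LinearIndepOn ℝ (edgeDiff id p) G.edgeSet) :
    (bisectorFlat p G : Set (EuclideanSpace ℝ (Fin n))).Nonempty ∧
      Module.finrank ℝ (bisectorFlat p G).direction + G.edgeSet.ncard = n := by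
  have := Fintype.ofFinite G.edgeSet
  set v : G.edgeSet → EuclideanSpace ℝ (Fin n) := fun e => edgeDiff id p e
  have hv : LinearIndependent ℝ v := h
  set L : EuclideanSpace ℝ (Fin n) →ₗ[ℝ] (G.edgeSet → ℝ) :=
    LinearMap.pi fun e => (2 : ℝ) • innerₛₗ ℝ (v e)
  have hL : ∀ x e, L x e = 2 * inner ℝ (v e) x := fun x e => by simp [L]
  have hmem : ∀ x, x ∈ bisectorFlat p G ↔
      L x = fun e : G.edgeSet => edgeDiff (fun y => ‖y‖ ^ 2) p e := by
    intro x
    rw [mem_bisectorFlat_iff_inner, funext_iff]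
    simp only [hL, Subtype.forall, v]
  have hker : LinearMap.ker L = (Submodule.span ℝ (Set.range v))ᗮ := by
    ext x
    rw [LinearMap.mem_ker, Submodule.mem_orthogonal, funext_iff]
    simp only [hL, Pi.zero_apply, mul_eq_zero, OfNat.ofNat_ne_zero, false_or]
    constructor
    · intro hx u hu
      induction hu using Submodule.span_induction with
      | mem u hu => obtain ⟨e, rfl⟩ := hu; exact hx e
      | zero => exact inner_zero_left _
      | add u w _ _ h1 h2 => rw [inner_add_left, h1, h2, add_zero]
      | smul c u _ h1 => rw [inner_smul_left, h1, mul_zero]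
    · exact fun hx e => hx _ (Submodule.subset_span ⟨e, rfl⟩)
  have hspan := finrank_span_eq_card hv
  have hcard : Fintype.card G.edgeSet = G.edgeSet.ncard := by
    rw [← Nat.card_eq_fintype_card, Nat.card_coe_set_eq]
  have horth := Submodule.finrank_add_finrank_orthogonal (Submodule.span ℝ (Set.range v))
  rw [← hker, hspan, finrank_euclideanSpace_fin] at horth
  have hrank := L.finrank_range_add_finrank_ker
  rw [finrank_euclideanSpace_fin] at hrank
  have hsurj : LinearMap.range L = ⊤ := by
    apply Submodule.eq_top_of_finrank_eq
    rw [Module.finrank_fintype_fun_eq_card]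
    omega
  obtain ⟨x, hx⟩ := LinearMap.range_eq_top.1 hsurj
    fun e : G.edgeSet => edgeDiff (fun y => ‖y‖ ^ 2) p e
  have hx' := (hmem x).2 hx
  refine ⟨⟨x, hx'⟩, ?_⟩
  have hdir : (bisectorFlat p G).direction = LinearMap.ker L := by
    ext w
    rw [← AffineSubspace.vadd_mem_iff_mem_direction w hx', hmem, LinearMap.mem_ker, vadd_eq_add,
      map_add, hx]
    exact add_eq_right
  rw [hdir, ← hcard]
  omega

/-- There are finitely many graphs. Up to n edges, independence is needed in ℝⁿ; for n + 1 edges the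
points are lifted to the paraboloid in ℝⁿ × ℝ. -/
theorem ae_isGeneric (hn : 1 ≤ n) : ∀ᵐ p : Fin k → EuclideanSpace ℝ (Fin n), IsGeneric p := by
  have : Nonempty (Fin n) := ⟨⟨0, hn⟩⟩
  have h₁ : ∀ G : SimpleGraph (Fin k), ∀ᵐ p : Fin k → EuclideanSpace ℝ (Fin n),
      G.IsAcyclic → G.edgeSet.ncard = n + 1 →
        LinearIndepOn ℝ (edgeDiff (fun y => (y, ‖y‖ ^ 2)) p) G.edgeSet := by
    intro G
    simp only [eventually_imp_distrib_left]
    exact fun hG hm => ae_linearIndepOn_edgeDiff (by fun_prop) ae_linearMap_norm_sq_ne _ G hG rfl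
      (by simp [hm])
  have h₂ : ∀ G : SimpleGraph (Fin k), ∀ᵐ p : Fin k → EuclideanSpace ℝ (Fin n),
      G.IsAcyclic → G.edgeSet.ncard ≤ n → LinearIndepOn ℝ (edgeDiff id p) G.edgeSet := by
    intro G
    simp only [eventually_imp_distrib_left]
    exact fun hG hm => ae_linearIndepOn_edgeDiff continuous_id ae_linearMap_ne _ G hG rfl
      (by simpa using hm)
  filter_upwards [ae_all_iff.2 h₁, ae_all_iff.2 h₂] with p hp₁ hp₂
  exact ⟨fun G hG hm => bisectorFlat_eq_empty (hp₁ G hG hm) hm,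
    fun G hG hm => bisectorFlat_nonempty_and_finrank (hp₂ G hG hm)⟩

end

end GoodTideman

theorem theorem6 (n k : ℕ) :
    (1 ≤ n → ∀ᵐ p : Fin k → EuclideanSpace ℝ (Fin n), GoodTideman.IsGeneric p) ∧
    ∀ p : Fin k → EuclideanSpace ℝ (Fin n), GoodTideman.IsGeneric p →
      (GoodTideman.observableOrders p).ncard = (GoodTideman.regions p).ncard ∧
      (GoodTideman.regions p).ncard =
        ∑ i ∈ Finset.range (n + 1), if i ≤ k then Nat.stirlingFirst k (k - i) else 0 := by
  refine ⟨GoodTideman.ae_isGeneric, fun p hp => ⟨?_, hp.ncard_regions⟩⟩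
  rw [GoodTideman.ncard_observableOrders, GoodTideman.ncard_regions]
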